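/- Let $d \ge 1$ be an integer, and let $S(d)$ be the symmetric group on $\{1,\dots,d\}$. In the Cayley graph of $S(d)$ generated by all transpositions, $\sigma$ is joined to $\sigma\,(s\ t)$ for $s<t$ by an edge, which is labelled $t$. A walk on this graph is called monotone if the labels of the edges it traverses form a weakly increasing sequence. For partitions $\alpha,\beta$ of $d$ and $r \ge 0$, let $\vec{W}^r(\alpha,\beta)$ be the number of monotone $r$-step walks which begin at a permutation of cycle type $\alpha$ and end at a permutation of cycle type $\beta$. For $g \in \mathbb{Z}$ define the disconnected monotone double Hurwitz numbers $$\vec{H}_g^{\bullet}(\alpha,\beta) = \vec{W}^{\,2g-2+\ell(\alpha)+\ell(\beta)}(\alpha,\beta),$$ where $\ell$ is the number of parts (the value is $0$ when the number of steps is negative), and the disconnected monotone simple Hurwitz numbers $$\vec{H}_g^{\bullet d} = \vec{H}_g^{\bullet}(1^d,1^d) = \vec{W}^{\,2g-2+2d}(1^d,1^d).$$ Then, for every fixed $d \ge 1$, $$\vec{H}_g^{\bullet d} \sim \frac{2\,(d-1)^{3d-3}}{(d-1)!\,d!}\,(d-1)^{2g}, \qquad g \to \infty .$$ Here $u_g \sim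 v_g$ means $u_g - v_g = o(v_g)$, and $0^0 = 1$; for $d=1$ the assertion is that both sides vanish for all large $g$. -/

import Mathlib

namespace MonotoneHurwitz

/-- In the Cayley graph of the symmetric group on `d` points, generated by all transpositions,
the vertices `σ` and `τ` are joined by an edge labelled `t`: that is, `τ = σ (s t)` for some
`s < t`. The label of an edge is the larger of the two points interchanged. -/
def IsEdge {d : ℕ} (t : Fin d) (σ τ : Equiv.Perm (Fin d)) : Prop :=
  ∃ s : Fin d, s < t ∧ τ = σ * Equiv.swap s t

/-- The vertex sequence `w 0, …, w r` is an `r`-step walk on the Cayley graph such that the labels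
of the edges traversed form a weakly increasing sequence. -/
def IsMonotoneWalk {d r : ℕ} (w : Fin (r + 1) → Equiv.Perm (Fin d)) : Prop :=
  ∃ t : Fin r → Fin d, Monotone t ∧ ∀ i : Fin r, IsEdge (t i) (w i.castSucc) (w i.succ)

/-- `σ` has cycle type `α`, a partition of `d` (fixed points are recorded as parts `1`). -/
def HasCycleType {d : ℕ} (σ : Equiv.Perm (Fin d)) (α : d.Partition) : Prop :=
  σ.partition.parts = α.parts

/-- The number of monotone `r`-step walks on the Cayley graph of the symmetric group on `d` points
which begin at a permutation of cycle type `α` and end at a permutation of cycle type `β`. -/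
noncomputable def walkCount {d : ℕ} (r : ℕ) (α β : d.Partition) : ℕ :=
  Set.ncard {w : Fin (r + 1) → Equiv.Perm (Fin d) |
    IsMonotoneWalk w ∧ HasCycleType (w 0) α ∧ HasCycleType (w (Fin.last r)) β}

/-- The disconnected monotone double Hurwitz number of genus `g` (an integer, possibly negative):
the number of monotone walks from `α` to `β` with `2g - 2 + ℓ(α) + ℓ(β)` steps, which is zero if
this number of steps is negative. -/
noncomputable def doubleHurwitz {d : ℕ} (g : ℤ) (α β : d.Partition) : ℕ :=
  let r : ℤ := 2 * g - 2 + (α.parts.card : ℤ) + (β.parts.card : ℤ)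
  if 0 ≤ r then walkCount r.toNat α β else 0

/-- The partition `1^d` of `d` into `d` parts equal to `1`. -/
def ones (d : ℕ) : d.Partition where
  parts := Multiset.replicate d 1
  parts_pos := by
    intro i hi
    rw [Multiset.eq_of_mem_replicate hi]
    exact Nat.one_pos
  parts_sum := by simp

/-- The disconnected monotone single Hurwitz number. -/
noncomputable def singleHurwitz {d : ℕ} (g : ℤ) (α : d.Partition) : ℕ :=
  doubleHurwitz g α (ones d)

/-- The disconnected monotone simple Hurwitz number of degree `d` and genus `g`. -/
noncomputable def simpleHurwitz (d : ℕ) (g : ℤ) : ℕ :=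
  singleHurwitz g (ones d)

end MonotoneHurwitz

/-! Put n = d - 1. A vertex 0 ≤ t ≤ n offers t edges labelled t at every permutation. Since labels
increase weakly, a walk is a run of steps with labels below n followed by a run of steps labelled n.
Counting end points freely, the walks with labels below m have generating function ∏_{j<m} 1/(1 -
jx). At x = 1/n the part with labels below n converges, with sum n^n/n!, so after scaling by n^(-r)
the total count tends to n^n/n!.

It remains to see how this mass spreads. A step labelled n acts on scaled counts as the average over
the transpositions moving the last point (`starAverage`). These generate the group, so the operator
strictly contracts the complement of the constants and the sign (`exists_norm_starAverage_le`),
while the input from smaller labels tends to zero. Hence the end point becomes uniform on the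
(n+1)!/2 permutations of the right parity (`tendsto_deviation_succ`). The identity, at even length
2g + 2n, receives the share 2/(n+1)!. -/

namespace MonotoneHurwitz

open Equiv Filter Topology

/-! ### Recursion on the largest label -/

/-- Monotone `r`-step walks from the identity to `σ`, all of whose labels are less than `m`. -/
def walksBelow {d : ℕ} (m r : ℕ) (σ : Perm (Fin d)) : Set (Fin (r + 1) → Perm (Fin d)) :=
  {w | w 0 = 1 ∧ w (Fin.last r) = σ ∧ ∃ t : Fin r → Fin d, Monotone t ∧
    (∀ i : Fin r, IsEdge (t i) (w i.castSucc) (w i.succ)) ∧ ∀ i, (t i : ℕ) < m}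

lemma swap_eq_swap_of_lt {d : ℕ} {s t s' t' : Fin d} (h : s < t) (h' : s' < t')
    (e : swap s t = swap s' t') : s = s' ∧ t = t' := by
  have hs : swap s' t' s = t := by rw [← e]; simp
  have ht : swap s' t' t = s := by rw [← e]; simp
  rw [swap_apply_def] at hs ht
  split_ifs at hs ht <;> grind

lemma IsEdge.label_unique {d : ℕ} {t t' : Fin d} {σ τ : Perm (Fin d)}
    (h : IsEdge t σ τ) (h' : IsEdge t' σ τ) : t = t' := by
  obtain ⟨s, hs, e⟩ := h
  obtain ⟨s', hs', e'⟩ := h'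
  exact (swap_eq_swap_of_lt hs hs' (mul_left_cancel (e.symm.trans e'))).2

/-- By monotonicity the last label is the largest, so either it is below `t`, and then all are, or
the last step is labelled `t` and can be removed. -/
lemma walksBelow_succ {d : ℕ} (t : Fin d) (r : ℕ) (σ : Perm (Fin d)) :
    walksBelow (t + 1) (r + 1) σ = walksBelow t (r + 1) σ ∪
      ⋃ s ∈ Finset.Iio t, (fun w : Fin (r + 1) → Perm (Fin d) => (Fin.snoc w σ : Fin (r + 2) → Perm (Fin d))) ''
        walksBelow (t + 1) r (σ * swap s t) := by
  ext w
  constructor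
  · rintro ⟨h0, h1, l, hm, he, hl⟩
    by_cases hlast : (l (Fin.last r) : ℕ) < t
    · exact Or.inl ⟨h0, h1, l, hm, he, fun i =>
        lt_of_le_of_lt (Fin.le_def.1 (hm (Fin.le_last i))) hlast⟩
    · right
      have hlt : l (Fin.last r) = t := by
        have := hl (Fin.last r)
        apply Fin.ext; omega
      obtain ⟨s, hs, e⟩ := he (Fin.last r)
      rw [hlt] at hs e
      rw [Fin.succ_last, h1] at e
      simp only [Set.mem_iUnion, Finset.mem_Iio]
      refine ⟨s, hs, Fin.init w, ⟨h0, ?_, fun i => l i.castSucc, ?_, ?_, ?_⟩, ?_⟩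
      · rw [e, mul_assoc, swap_mul_self, mul_one]; rfl
      · exact fun i j h => hm h
      · exact fun i => he i.castSucc
      · exact fun i => hl _
      · simp only [← h1]
        exact Fin.snoc_init_self w
  · rintro (⟨h0, h1, l, hm, he, hl⟩ | h)
    · exact ⟨h0, h1, l, hm, he, fun i => (hl i).trans (Nat.lt_succ_self _)⟩
    · simp only [Set.mem_iUnion, Finset.mem_Iio] at h
      obtain ⟨s, hs, w, ⟨h0, h1, l, hm, he, hl⟩, rfl⟩ := h
      refine ⟨?_, by simp, (Fin.snoc l t : Fin (r + 1) → Fin d), ?_, ?_, ?_⟩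
      · exact (Fin.snoc_castSucc (α := fun _ => Perm (Fin d)) σ w 0).trans h0
      · intro i j hij
        induction j using Fin.lastCases with
        | last =>
          induction i using Fin.lastCases with
          | last => simp
          | cast i =>
            have : l i ≤ t := Nat.lt_succ_iff.1 (hl i)
            simpa using this
        | cast j =>
          induction i using Fin.lastCases with
          | last => exact absurd hij (by simp)
          | cast i => simpa using hm (by simpa using hij)
      · intro i
        induction i using Fin.lastCases with
        | last =>
          refine ⟨s, by simpa using hs, ?_⟩
          simp [h1, mul_assoc, Fin.succ_last]
        | cast i =>
          simpa only [Fin.snoc_castSucc, Fin.succ_castSucc] using he i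
      · intro i
        induction i using Fin.lastCases with
        | last => simp
        | cast i => simpa using hl i

lemma ncard_biUnion {ι α : Type*} [Finite α] (S : Finset ι) (f : ι → Set α)
    (h : (S : Set ι).PairwiseDisjoint f) : (⋃ i ∈ S, f i).ncard = ∑ i ∈ S, (f i).ncard := by
  classical
  induction S using Finset.induction_on with
  | empty => simp
  | insert a S ha ih =>
    rw [Finset.set_biUnion_insert, Finset.sum_insert ha, Set.ncard_union_eq ?_
      (Set.toFinite _) (Set.toFinite _), ih (h.subset (by simp))]
    rw [Set.disjoint_iUnion₂_right]
    intro i hi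
    exact h (by simp) (by simp [hi]) (by rintro rfl; exact ha hi)

lemma ncard_walksBelow_succ {d : ℕ} (t : Fin d) (r : ℕ) (σ : Perm (Fin d)) :
    (walksBelow (t + 1) (r + 1) σ).ncard = (walksBelow t (r + 1) σ).ncard +
      ∑ s ∈ Finset.Iio t, (walksBelow (t + 1) r (σ * swap s t)).ncard := by
  rw [walksBelow_succ, Set.ncard_union_eq ?_ (Set.toFinite _) (Set.toFinite _)]
  · congr 1
    rw [ncard_biUnion]
    · exact Finset.sum_congr rfl fun s _ => Set.ncard_image_of_injective _ fun w w' h => by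
        simpa using congrArg Fin.init h
    · intro s hs s' hs' hne
      rw [Function.onFun, Set.disjoint_left]
      rintro _ ⟨w, hw, rfl⟩ ⟨w', hw', e⟩
      have hww : w' = w := by simpa using congrArg Fin.init e
      have e' : swap s t = swap s' t := by
        rw [hww] at hw'
        exact mul_left_cancel (hw.2.1.symm.trans hw'.2.1)
      exact hne (swap_eq_swap_of_lt (by simpa using hs) (by simpa using hs') e').1
  -- An edge determines its label, so a walk whose last step is labelled `t` cannot also be labelled
  -- below `t`.
  · rw [Set.disjoint_left]
    rintro w ⟨h0, h1, l, hm, he, hl⟩ h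
    simp only [Set.mem_iUnion, Finset.mem_Iio] at h
    obtain ⟨s, hs, w, ⟨h0', h1', -⟩, rfl⟩ := h
    have h2 := he (Fin.last r)
    have h3 : IsEdge t ((Fin.snoc w σ : Fin (r + 2) → Perm (Fin d)) (Fin.last r).castSucc)
        ((Fin.snoc w σ : Fin (r + 2) → Perm (Fin d)) (Fin.last r).succ) :=
      ⟨s, hs, by simp [h1', mul_assoc, Fin.succ_last]⟩
    have := hl (Fin.last r)
    rw [h2.label_unique h3] at this
    exact lt_irrefl _ this

lemma walksBelow_zero_succ {d : ℕ} (r : ℕ) (σ : Perm (Fin d)) : walksBelow 0 (r + 1) σ = ∅ := by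
  rw [Set.eq_empty_iff_forall_notMem]
  rintro w ⟨-, -, l, -, -, hl⟩
  exact absurd (hl 0) (Nat.not_lt_zero _)

lemma ncard_walksBelow_zero {d : ℕ} (m : ℕ) (σ : Perm (Fin d)) :
    (walksBelow m 0 σ).ncard = if σ = 1 then 1 else 0 := by
  split_ifs with h
  · rw [Set.ncard_eq_one]
    refine ⟨fun _ => 1, Set.ext fun w => ⟨fun hw => ?_, ?_⟩⟩
    · funext i
      rw [Fin.fin_one_eq_zero i]; exact hw.1
    · rintro rfl
      exact ⟨rfl, h.symm, Fin.elim0, fun i => i.elim0, fun i => i.elim0, fun i => i.elim0⟩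
  · rw [Set.ncard_eq_zero, Set.eq_empty_iff_forall_notMem]
    rintro w ⟨h0, h1, -⟩
    exact h (h1.symm.trans h0)

/-! ### Hurwitz numbers as closed walks at the identity -/

lemma hasCycleType_ones_iff {d : ℕ} (σ : Perm (Fin d)) : HasCycleType σ (ones d) ↔ σ = 1 := by
  constructor
  · intro h
    rw [← Perm.cycleType_eq_zero, ← Perm.filter_parts_partition_eq_cycleType, h]
    rw [Multiset.filter_eq_nil]
    intro a ha
    rw [Multiset.eq_of_mem_replicate ha]; norm_num
  · rintro rfl
    simp [HasCycleType, ones, Perm.parts_partition]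

lemma walkCount_ones {d : ℕ} (r : ℕ) :
    walkCount r (ones d) (ones d) = (walksBelow d r (1 : Perm (Fin d))).ncard := by
  unfold walkCount
  congr 1
  ext w
  simp only [Set.mem_ofPred_eq, hasCycleType_ones_iff, walksBelow, IsMonotoneWalk]
  constructor
  · rintro ⟨⟨l, hm, he⟩, h0, h1⟩
    exact ⟨h0, h1, l, hm, he, fun i => (l i).2⟩
  · rintro ⟨h0, h1, l, hm, he, -⟩
    exact ⟨⟨l, hm, he⟩, h0, h1⟩

lemma simpleHurwitz_eq {d : ℕ} {g : ℤ} (hd : 1 ≤ d) (hg : 0 ≤ g) :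
    simpleHurwitz d g = (walksBelow d (2 * (g.toNat + (d - 1))) (1 : Perm (Fin d))).ncard := by
  have h : (2 * g - 2 + ((ones d).parts.card : ℤ) + ((ones d).parts.card : ℤ)) =
      ((2 * (g.toNat + (d - 1)) : ℕ) : ℤ) := by
    simp only [ones, Multiset.card_replicate]
    omega
  simp only [simpleHurwitz, singleHurwitz, doubleHurwitz]
  rw [h, if_pos (Int.natCast_nonneg _), Int.toNat_natCast, walkCount_ones]

/-! ### Total counts and their generating function -/

/-- The number of monotone `r`-step walks from the identity with labels less than `m`. -/
noncomputable def walkTotal (d m r : ℕ) : ℝ :=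
  ∑ σ : Perm (Fin d), ((walksBelow m r σ).ncard : ℝ)

/-- The sign of a permutation, as a real number. -/
def realSign {d : ℕ} (σ : Perm (Fin d)) : ℝ := ((Perm.sign σ : ℤ) : ℝ)

lemma realSign_mul_swap {d : ℕ} (σ : Perm (Fin d)) {s t : Fin d} (h : s ≠ t) :
    realSign (σ * swap s t) = -realSign σ := by
  simp [realSign, Perm.sign_swap h]

lemma realSign_mul_self {d : ℕ} (σ : Perm (Fin d)) : realSign σ * realSign σ = 1 := by
  rcases Int.units_eq_one_or (Perm.sign σ) with h | h <;> simp [realSign, h]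

lemma sum_mul_swap {d : ℕ} (s t : Fin d) (f : Perm (Fin d) → ℝ) :
    ∑ σ, f (σ * swap s t) = ∑ σ, f σ :=
  Equiv.sum_comp (Equiv.mulRight (swap s t)) f

lemma walkTotal_zero (d m : ℕ) : walkTotal d m 0 = 1 := by
  simp [walkTotal, ncard_walksBelow_zero]

lemma walkTotal_zero_succ (d r : ℕ) : walkTotal d 0 (r + 1) = 0 := by
  simp [walkTotal, walksBelow_zero_succ]

lemma walkTotal_succ_succ {d m : ℕ} (hm : m < d) (r : ℕ) :
    walkTotal d (m + 1) (r + 1) = walkTotal d m (r + 1) + m * walkTotal d (m + 1) r := by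
  have key := fun σ => ncard_walksBelow_succ (⟨m, hm⟩ : Fin d) r σ
  simp only at key
  simp only [walkTotal, key, Nat.cast_add, Nat.cast_sum, Finset.sum_add_distrib]
  rw [Finset.sum_comm]
  congr 1
  rw [Finset.sum_congr rfl fun s _ => sum_mul_swap s ⟨m, hm⟩
    fun σ => ((walksBelow (m + 1) r σ).ncard : ℝ)]
  simp

/-- Each step flips the sign, so every `r`-step walk from the identity ends at sign `(-1) ^ r`. -/
lemma sum_realSign_mul_ncard {d m : ℕ} (hm : m ≤ d) (r : ℕ) :
    ∑ σ : Perm (Fin d), realSign σ * ((walksBelow m r σ).ncard : ℝ) =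
      (-1) ^ r * walkTotal d m r := by
  induction m generalizing r with
  | zero =>
    cases r with
    | zero => simp [walkTotal_zero, ncard_walksBelow_zero, realSign]
    | succ r => simp [walkTotal_zero_succ, walksBelow_zero_succ]
  | succ m ih =>
    induction r with
    | zero => simp [walkTotal_zero, ncard_walksBelow_zero, realSign]
    | succ r ihr =>
      have key := fun σ => ncard_walksBelow_succ (⟨m, hm⟩ : Fin d) r σ
      simp only at key
      rw [walkTotal_succ_succ hm, mul_add, ← ih (Nat.le_of_succ_le hm)]
      simp only [key, Nat.cast_add, Nat.cast_sum, mul_add, Finset.sum_add_distrib, Finset.mul_sum]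
      rw [Finset.sum_comm]
      congr 1
      have h : ∀ s ∈ Finset.Iio (⟨m, hm⟩ : Fin d), ∑ σ : Perm (Fin d), realSign σ *
          ((walksBelow (m + 1) r (σ * swap s ⟨m, hm⟩)).ncard : ℝ) =
            -((-1) ^ r * walkTotal d (m + 1) r) := by
        intro s hs
        rw [← ihr, ← sum_mul_swap s ⟨m, hm⟩,
          ← Finset.sum_neg_distrib]
        refine Finset.sum_congr rfl fun σ _ => ?_
        rw [realSign_mul_swap _ (Finset.mem_Iio.1 hs).ne, mul_assoc, swap_mul_self, mul_one, neg_mul]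
      rw [Finset.sum_congr rfl h]
      simp
      ring

lemma walkTotal_succ_eq_sum {d m : ℕ} (hm : m < d) (r : ℕ) :
    walkTotal d (m + 1) r = ∑ k ∈ Finset.range (r + 1), walkTotal d m k * (m : ℝ) ^ (r - k) := by
  induction r with
  | zero => simp [walkTotal_zero]
  | succ r ih =>
    rw [walkTotal_succ_succ hm, Finset.sum_range_succ, ih, Finset.mul_sum, add_comm]
    congr 1
    · refine Finset.sum_congr rfl fun k hk => ?_
      rw [Nat.succ_sub (Nat.lt_succ_iff.1 (Finset.mem_range.1 hk)), pow_succ]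
      ring
    · simp

/-- Admitting one more label `m` multiplies the series by the geometric series of ratio `m * x`, as
a Cauchy product. -/
lemma hasSum_walkTotal {d m : ℕ} (hm : m ≤ d) {x : ℝ} (hx : 0 ≤ x)
    (h : ∀ j < m, (j : ℝ) * x < 1) :
    HasSum (fun r => walkTotal d m r * x ^ r) (∏ j ∈ Finset.range m, (1 - (j : ℝ) * x)⁻¹) := by
  induction m with
  | zero =>
    convert hasSum_single (f := fun r => walkTotal d 0 r * x ^ r) 0 ?_ using 1
    · simp [walkTotal_zero]
    · intro r hr
      obtain ⟨k, rfl⟩ := Nat.exists_eq_succ_of_ne_zero hr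
      simp [walkTotal_zero_succ]
  | succ m ih =>
    have h1 := ih (Nat.le_of_succ_le hm) fun j hj => h j (hj.trans (Nat.lt_succ_self m))
    have hmx : 0 ≤ (m : ℝ) * x := by positivity
    have h2 := hasSum_geometric_of_lt_one hmx (h m (Nat.lt_succ_self m))
    have h3 := hasSum_sum_range_mul_of_summable_norm h1.summable.norm h2.summable.norm
    rw [h1.tsum_eq, h2.tsum_eq] at h3
    rw [Finset.prod_range_succ]
    refine (funext fun r => ?_ : (fun r => walkTotal d (m + 1) r * x ^ r) = _) ▸ h3
    rw [walkTotal_succ_eq_sum hm, Finset.sum_mul]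
    refine Finset.sum_congr rfl fun k hk => ?_
    rw [mul_pow, ← Nat.add_sub_of_le (Nat.lt_succ_iff.1 (Finset.mem_range.1 hk))]
    simp only [Nat.add_sub_cancel_left, pow_add]
    ring

lemma prod_one_sub_div_inv {n : ℕ} (hn : n ≠ 0) :
    ∏ j ∈ Finset.range n, (1 - (j : ℝ) * (n : ℝ)⁻¹)⁻¹ = (n : ℝ) ^ n / (n.factorial : ℝ) := by
  have hn' : (n : ℝ) ≠ 0 := Nat.cast_ne_zero.2 hn
  have h : ∀ j ∈ Finset.range n, (1 - (j : ℝ) * (n : ℝ)⁻¹)⁻¹ = (n : ℝ) / ((n - j : ℕ) : ℝ) := by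
    intro j hj
    rw [Nat.cast_sub (Finset.mem_range.1 hj).le]
    field_simp
  rw [Finset.prod_congr rfl h, Finset.prod_div_distrib, Finset.prod_const, Finset.card_range,
    ← Nat.cast_prod]
  congr 2
  rw [← Nat.descFactorial_self, Nat.descFactorial_eq_prod_range]

/-! ### Contraction by the star average -/

lemma tendsto_zero_of_le_add_mul {u ε : ℕ → ℝ} {q : ℝ} (hu : ∀ r, 0 ≤ u r) (hq : 0 ≤ q)
    (hq1 : q < 1) (h : ∀ r, u (r + 1) ≤ ε (r + 1) + q * u r) (hε : Tendsto ε atTop (𝓝 0)) :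
    Tendsto u atTop (𝓝 0) := by
  rw [Metric.tendsto_atTop]
  intro δ hδ
  -- Chosen so that `δ / 2` is the fixed point of `x ↦ δ / 2 * (1 - q) + q * x`.
  have hpos : 0 < δ / 2 * (1 - q) := by have := sub_pos.2 hq1; positivity
  obtain ⟨N, hN⟩ := eventually_atTop.1 (hε.eventually (gt_mem_nhds hpos))
  have hb : ∀ j, u (N + j) ≤ δ / 2 + q ^ j * u N := by
    intro j
    induction j with
    | zero => simp; positivity
    | succ j ih =>
      have h1 := h (N + j)
      have h2 := hN (N + j + 1) (by omega)
      have h3 := mul_le_mul_of_nonneg_left ih hq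
      rw [← add_assoc, pow_succ]
      linarith
  have ht : Tendsto (fun j => δ / 2 + q ^ j * u N) atTop (𝓝 (δ / 2 + 0 * u N)) :=
    ((tendsto_pow_atTop_nhds_zero_of_lt_one hq hq1).mul_const _).const_add _
  obtain ⟨M, hM⟩ := eventually_atTop.1 (ht.eventually_lt_const (u := δ) (by linarith))
  refine ⟨N + M, fun r hr => ?_⟩
  obtain ⟨j, rfl⟩ := Nat.exists_eq_add_of_le ((Nat.le_add_right N M).trans hr)
  rw [Real.dist_eq, sub_zero, abs_of_nonneg (hu _)]
  exact (hb j).trans_lt (hM j (by omega))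

/-- A function on the symmetric group that is invariant under right multiplication by the
transpositions moving a given point is constant. -/
lemma eq_of_mul_swap_invariant {d : ℕ} (t : Fin d) (f : Perm (Fin d) → ℝ)
    (h : ∀ s, s ≠ t → ∀ σ, f (σ * swap s t) = f σ) (σ : Perm (Fin d)) : f σ = f 1 := by
  have key : ∀ a b : Fin d, a ≠ b → ∀ σ, f (σ * swap a b) = f σ := by
    intro a b hab σ
    by_cases hb : b = t
    · subst hb; exact h a hab σ
    by_cases ha : a = t
    · subst ha; rw [swap_comm]; exact h b hb σ
    -- Conjugation expresses any transposition through those moving `t`.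
    have e : swap a b = swap a t * swap b t * swap a t := by
      rw [swap_comm a t, swap_mul_swap_mul_swap hb hab.symm]
    rw [e, ← mul_assoc, ← mul_assoc, h a ha, h b hb, h a ha]
  induction σ using Perm.swap_induction_on' with
  | one => rfl
  | mul_swap σ a b hab ih => rw [key a b hab, ih]

/-- The average over right translates by the transpositions moving the last point. -/
noncomputable def starAverage (n : ℕ) : EuclideanSpace ℝ (Perm (Fin (n + 1))) →ₗ[ℝ]
    EuclideanSpace ℝ (Perm (Fin (n + 1))) where
  toFun f := WithLp.toLp 2 fun σ =>
    (n : ℝ)⁻¹ * ∑ s ∈ Finset.Iio (Fin.last n), f (σ * swap s (Fin.last n))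
  map_add' f g := by
    ext σ
    simp [Finset.sum_add_distrib, mul_add]
  map_smul' c f := by
    ext σ
    simp only [PiLp.smul_apply, smul_eq_mul, ← Finset.mul_sum, RingHom.id_apply]
    ring

lemma starAverage_apply (n : ℕ) (f : EuclideanSpace ℝ (Perm (Fin (n + 1))))
    (σ : Perm (Fin (n + 1))) : starAverage n f σ =
      (n : ℝ)⁻¹ * ∑ s ∈ Finset.Iio (Fin.last n), f (σ * swap s (Fin.last n)) := rfl

/-- The variance identity at each `σ`, summed over the group: the loss of norm is the total variance
of `f` over neighbours. -/
lemma norm_sq_sub_norm_sq_starAverage {n : ℕ} (hn : n ≠ 0)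
    (f : EuclideanSpace ℝ (Perm (Fin (n + 1)))) :
    ‖f‖ ^ 2 - ‖starAverage n f‖ ^ 2 = (n : ℝ)⁻¹ * ∑ σ, ∑ s ∈ Finset.Iio (Fin.last n),
      (f (σ * swap s (Fin.last n)) - starAverage n f σ) ^ 2 := by
  have hn' : (n : ℝ) ≠ 0 := Nat.cast_ne_zero.2 hn
  have h1 : ∀ σ, ∑ s ∈ Finset.Iio (Fin.last n),
      (f (σ * swap s (Fin.last n)) - starAverage n f σ) ^ 2 =
      ∑ s ∈ Finset.Iio (Fin.last n), f (σ * swap s (Fin.last n)) ^ 2 -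
        n * starAverage n f σ ^ 2 := by
    intro σ
    have h2 : ∑ s ∈ Finset.Iio (Fin.last n), f (σ * swap s (Fin.last n)) =
        n * starAverage n f σ := by
      rw [starAverage_apply, mul_inv_cancel_left₀ hn']
    simp only [sub_sq, Finset.sum_add_distrib, Finset.sum_sub_distrib, ← Finset.sum_mul,
      ← Finset.mul_sum, h2, Finset.sum_const, Fin.card_Iio, Fin.val_last, nsmul_eq_mul]
    ring
  have h3 : ∑ σ : Perm (Fin (n + 1)), ∑ s ∈ Finset.Iio (Fin.last n),
      f (σ * swap s (Fin.last n)) ^ 2 = n * ∑ σ, f σ ^ 2 := by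
    rw [Finset.sum_comm, Finset.sum_congr rfl fun s _ =>
      sum_mul_swap s (Fin.last n) fun σ => f σ ^ 2]
    simp
  rw [Finset.sum_congr rfl fun σ _ => h1 σ, Finset.sum_sub_distrib, h3, ← Finset.mul_sum,
    EuclideanSpace.real_norm_sq_eq, EuclideanSpace.real_norm_sq_eq]
  field_simp

lemma norm_starAverage_lt {n : ℕ} (hn : n ≠ 0) (f : EuclideanSpace ℝ (Perm (Fin (n + 1))))
    (h0 : ∑ σ, f σ = 0) (h1 : ∑ σ, realSign σ * f σ = 0) (hf : f ≠ 0) :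
    ‖starAverage n f‖ < ‖f‖ := by
  by_contra hlt
  have hid := norm_sq_sub_norm_sq_starAverage hn f
  have hle : ‖f‖ ^ 2 - ‖starAverage n f‖ ^ 2 ≤ 0 :=
    sub_nonpos.2 (pow_le_pow_left₀ (norm_nonneg _) (not_lt.1 hlt) 2)
  have hnpos : (0 : ℝ) < (n : ℝ)⁻¹ := inv_pos.2 (Nat.cast_pos.2 (Nat.pos_of_ne_zero hn))
  have hsum : ∑ σ, ∑ s ∈ Finset.Iio (Fin.last n),
      (f (σ * swap s (Fin.last n)) - starAverage n f σ) ^ 2 = 0 := by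
    refine le_antisymm ?_ (Finset.sum_nonneg fun _ _ => Finset.sum_nonneg fun _ _ => sq_nonneg _)
    rw [hid] at hle
    exact nonpos_of_mul_nonpos_right hle hnpos
  -- With zero variance, each transposition moving the last point interchanges `f` and its average.
  -- Their sum is then invariant, and so is their difference times the sign; both are constant, and
  -- `f` is a combination of 1 and the sign, to both of which it is orthogonal.
  have hmove : ∀ s, s ≠ Fin.last n → ∀ σ, f (σ * swap s (Fin.last n)) = starAverage n f σ := by
    intro s hs σ
    rw [Finset.sum_eq_zero_iff_of_nonneg
      fun _ _ => Finset.sum_nonneg fun _ _ => sq_nonneg _] at hsum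
    have h2 := hsum σ (Finset.mem_univ _)
    rw [Finset.sum_eq_zero_iff_of_nonneg fun _ _ => sq_nonneg _] at h2
    exact sub_eq_zero.1 (pow_eq_zero_iff two_ne_zero |>.1
      (h2 s (Finset.mem_Iio.2 (Fin.lt_last_iff_ne_last.2 hs))))
  have hmove' : ∀ s, s ≠ Fin.last n → ∀ σ, starAverage n f (σ * swap s (Fin.last n)) = f σ := by
    intro s hs σ
    rw [← hmove s hs, mul_assoc, swap_mul_self, mul_one]
  have hadd := eq_of_mul_swap_invariant (Fin.last n) (fun σ => f σ + starAverage n f σ)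
    fun s hs σ => by simp only [hmove s hs, hmove' s hs]; ring
  have hsub := eq_of_mul_swap_invariant (Fin.last n)
    (fun σ => realSign σ * (f σ - starAverage n f σ))
    fun s hs σ => by simp only [hmove s hs, hmove' s hs, realSign_mul_swap _ hs]; ring
  simp only at hadd hsub
  set a := f 1 + starAverage n f 1
  set b := realSign 1 * (f 1 - starAverage n f 1)
  have hform : ∀ σ, f σ = a / 2 + b / 2 * realSign σ := by
    intro σ
    have := realSign_mul_self σ
    rw [← hadd σ, ← hsub σ]
    linear_combination (-(f σ - starAverage n f σ) / 2) * this
  have hzero : ‖f‖ ^ 2 = 0 := by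
    rw [EuclideanSpace.real_norm_sq_eq]
    have : ∀ σ, f σ ^ 2 = a / 2 * f σ + b / 2 * (realSign σ * f σ) := by
      intro σ
      linear_combination f σ * hform σ
    rw [Finset.sum_congr rfl fun σ _ => this σ, Finset.sum_add_distrib, ← Finset.mul_sum,
      ← Finset.mul_sum, h0, h1]
    simp
  exact hf (norm_eq_zero.1 (pow_eq_zero_iff two_ne_zero |>.1 hzero))

/-- Compactness of the unit sphere of the subspace turns the strict inequality into a uniform
factor. -/
lemma exists_norm_starAverage_le {n : ℕ} (hn : n ≠ 0) :
    ∃ q : ℝ, 0 ≤ q ∧ q < 1 ∧ ∀ f : EuclideanSpace ℝ (Perm (Fin (n + 1))),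
      ∑ σ, f σ = 0 → ∑ σ, realSign σ * f σ = 0 → ‖starAverage n f‖ ≤ q * ‖f‖ := by
  set K : Set (EuclideanSpace ℝ (Perm (Fin (n + 1)))) :=
    Metric.sphere 0 1 ∩ ({f | ∑ σ, f σ = 0} ∩ {f | ∑ σ, realSign σ * f σ = 0}) with hK
  have hKc : IsCompact K := by
    refine (isCompact_sphere 0 1).inter_right (IsClosed.inter ?_ ?_)
    · exact isClosed_eq (by fun_prop) continuous_const
    · exact isClosed_eq (by fun_prop) continuous_const
  have hcont : Continuous fun f => ‖starAverage n f‖ :=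
    (starAverage n).continuous_of_finiteDimensional.norm
  have hq : ∃ q : ℝ, 0 ≤ q ∧ q < 1 ∧ ∀ f ∈ K, ‖starAverage n f‖ ≤ q := by
    rcases K.eq_empty_or_nonempty with he | hne
    · exact ⟨0, le_rfl, one_pos, by simp [he]⟩
    · obtain ⟨f, hf, hmax⟩ := hKc.exists_isMaxOn hne hcont.continuousOn
      refine ⟨‖starAverage n f‖, norm_nonneg _, ?_, fun g hg => hmax hg⟩
      have hf1 : ‖f‖ = 1 := by simpa using hf.1
      rw [← hf1]
      exact norm_starAverage_lt hn f hf.2.1 hf.2.2 (norm_ne_zero_iff.1 (by simp [hf1]))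
  obtain ⟨q, hq0, hq1, hq⟩ := hq
  refine ⟨q, hq0, hq1, fun f h0 h1 => ?_⟩
  rcases eq_or_ne f 0 with rfl | hf
  · simp
  have hfn : ‖f‖ ≠ 0 := norm_ne_zero_iff.2 hf
  have hmem : ‖f‖⁻¹ • f ∈ K := by
    refine ⟨?_, ?_, ?_⟩
    · simp [norm_smul, hfn]
    · simp [← Finset.mul_sum, h0]
    · simp only [Set.mem_ofPred_eq, PiLp.smul_apply, smul_eq_mul, mul_left_comm _ ‖f‖⁻¹,
        ← Finset.mul_sum, h1, mul_zero]
  have := hq _ hmem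
  rw [map_smul, norm_smul, norm_inv, norm_norm, inv_mul_le_iff₀ (norm_pos_iff.2 hf)] at this
  rwa [mul_comm]

/-! ### Equidistribution of end points on parity classes -/

/-- The uniform distribution on the permutations of sign `(-1) ^ r`. -/
noncomputable def parityUniform (n r : ℕ) : EuclideanSpace ℝ (Perm (Fin (n + 1))) :=
  WithLp.toLp 2 fun σ => (1 + (-1) ^ r * realSign σ) / ((n + 1).factorial : ℝ)

lemma parityUniform_apply (n r : ℕ) (σ : Perm (Fin (n + 1))) :
    parityUniform n r σ = (1 + (-1) ^ r * realSign σ) / ((n + 1).factorial : ℝ) := rfl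

lemma sum_realSign {n : ℕ} (hn : n ≠ 0) : ∑ σ : Perm (Fin (n + 1)), realSign σ = 0 := by
  have hne : (0 : Fin (n + 1)) ≠ Fin.last n := fun h => hn (by simpa using congrArg Fin.val h.symm)
  have h := sum_mul_swap 0 (Fin.last n) (realSign (d := n + 1))
  simp only [realSign_mul_swap _ hne, Finset.sum_neg_distrib] at h
  linarith

lemma sum_parityUniform {n : ℕ} (hn : n ≠ 0) (r : ℕ) : ∑ σ, parityUniform n r σ = 1 := by
  have h : ((n + 1).factorial : ℝ) ≠ 0 := Nat.cast_ne_zero.2 (Nat.factorial_ne_zero _)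
  simp only [parityUniform_apply, ← Finset.sum_div, Finset.sum_add_distrib, ← Finset.mul_sum,
    sum_realSign hn]
  simp [Fintype.card_perm, h]

lemma sum_realSign_mul_parityUniform {n : ℕ} (hn : n ≠ 0) (r : ℕ) :
    ∑ σ, realSign σ * parityUniform n r σ = (-1) ^ r := by
  have h : ((n + 1).factorial : ℝ) ≠ 0 := Nat.cast_ne_zero.2 (Nat.factorial_ne_zero _)
  have e : ∀ σ : Perm (Fin (n + 1)), realSign σ * parityUniform n r σ =
      (realSign σ + (-1) ^ r) / ((n + 1).factorial : ℝ) := by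
    intro σ
    rw [parityUniform_apply, mul_div_assoc', mul_add, mul_left_comm, realSign_mul_self]
    ring
  rw [Finset.sum_congr rfl fun σ _ => e σ, ← Finset.sum_div, Finset.sum_add_distrib,
    sum_realSign hn]
  simp [Fintype.card_perm, h]

lemma starAverage_parityUniform {n : ℕ} (hn : n ≠ 0) (r : ℕ) :
    starAverage n (parityUniform n r) = parityUniform n (r + 1) := by
  have hn' : (n : ℝ) ≠ 0 := Nat.cast_ne_zero.2 hn
  ext σ
  rw [starAverage_apply, parityUniform_apply, Finset.sum_congr rfl (g := fun _ =>
    (1 + (-1) ^ (r + 1) * realSign σ) / ((n + 1).factorial : ℝ))]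
  · simp [hn']
  · intro s hs
    rw [parityUniform_apply, realSign_mul_swap _ (Finset.mem_Iio.1 hs).ne, pow_succ]
    ring

/-- Walk counts by end point, scaled by the largest possible number of choices per step. -/
noncomputable def scaledCount (n m r : ℕ) : EuclideanSpace ℝ (Perm (Fin (n + 1))) :=
  WithLp.toLp 2 fun σ => ((walksBelow m r σ).ncard : ℝ) * (n : ℝ)⁻¹ ^ r

lemma scaledCount_apply (n m r : ℕ) (σ : Perm (Fin (n + 1))) :
    scaledCount n m r σ = ((walksBelow m r σ).ncard : ℝ) * (n : ℝ)⁻¹ ^ r := rfl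

lemma scaledCount_succ (n r : ℕ) : scaledCount n (n + 1) (r + 1) =
    scaledCount n n (r + 1) + starAverage n (scaledCount n (n + 1) r) := by
  ext σ
  have h := ncard_walksBelow_succ (Fin.last n) r σ
  rw [Fin.val_last] at h
  simp only [PiLp.add_apply, starAverage_apply, scaledCount_apply, h, ← Finset.sum_mul, pow_succ]
  push_cast
  ring

/-- The total number of walks, scaled likewise. -/
noncomputable def scaledTotal (n m r : ℕ) : ℝ := walkTotal (n + 1) m r * (n : ℝ)⁻¹ ^ r

lemma scaledTotal_succ {n : ℕ} (hn : n ≠ 0) (r : ℕ) :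
    scaledTotal n (n + 1) (r + 1) = scaledTotal n n (r + 1) + scaledTotal n (n + 1) r := by
  have hn' : (n : ℝ) ≠ 0 := Nat.cast_ne_zero.2 hn
  rw [scaledTotal, walkTotal_succ_succ (Nat.lt_succ_self n), scaledTotal, scaledTotal, add_mul,
    pow_succ]
  field_simp

lemma hasSum_scaledTotal {n : ℕ} (hn : n ≠ 0) :
    HasSum (scaledTotal n n) ((n : ℝ) ^ n / (n.factorial : ℝ)) := by
  rw [← prod_one_sub_div_inv hn]
  refine hasSum_walkTotal (Nat.le_succ n) (by positivity) fun j hj => ?_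
  rw [← div_eq_mul_inv, div_lt_one (Nat.cast_pos.2 (Nat.pos_of_ne_zero hn))]
  exact Nat.cast_lt.2 hj

lemma tendsto_scaledTotal {n : ℕ} (hn : n ≠ 0) :
    Tendsto (scaledTotal n (n + 1)) atTop (𝓝 ((n : ℝ) ^ n / (n.factorial : ℝ))) := by
  have h : ∀ r, scaledTotal n (n + 1) r = ∑ k ∈ Finset.range (r + 1), scaledTotal n n k := by
    intro r
    induction r with
    | zero => simp [scaledTotal, walkTotal_zero]
    | succ r ih => rw [scaledTotal_succ hn, Finset.sum_range_succ, ih, add_comm]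
  simp only [funext h]
  exact (hasSum_scaledTotal hn).tendsto_sum_nat.comp (tendsto_add_atTop_nat 1)

/-- The deviation of the end point distribution from the uniform one on its parity class. -/
noncomputable def deviation (n m r : ℕ) : EuclideanSpace ℝ (Perm (Fin (n + 1))) :=
  scaledCount n m r - scaledTotal n m r • parityUniform n r

lemma deviation_apply (n m r : ℕ) (σ : Perm (Fin (n + 1))) : deviation n m r σ =
    scaledCount n m r σ - scaledTotal n m r * parityUniform n r σ := rfl

lemma sum_deviation {n : ℕ} (hn : n ≠ 0) (m r : ℕ) : ∑ σ, deviation n m r σ = 0 := by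
  simp only [deviation_apply, Finset.sum_sub_distrib, ← Finset.mul_sum, sum_parityUniform hn,
    scaledCount_apply, ← Finset.sum_mul, scaledTotal, walkTotal]
  ring

lemma sum_realSign_mul_deviation {n m : ℕ} (hn : n ≠ 0) (hm : m ≤ n + 1) (r : ℕ) :
    ∑ σ, realSign σ * deviation n m r σ = 0 := by
  have e : ∀ σ : Perm (Fin (n + 1)), realSign σ * deviation n m r σ =
      realSign σ * ((walksBelow m r σ).ncard : ℝ) * (n : ℝ)⁻¹ ^ r -
        scaledTotal n m r * (realSign σ * parityUniform n r σ) := by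
    intro σ
    rw [deviation_apply, scaledCount_apply]
    ring
  rw [Finset.sum_congr rfl fun σ _ => e σ, Finset.sum_sub_distrib, ← Finset.sum_mul,
    ← Finset.mul_sum, sum_realSign_mul_parityUniform hn, sum_realSign_mul_ncard hm, scaledTotal]
  ring

/-- Counts and uniform part obey the same recursion, since averaging swaps the two parity classes;
so their difference obeys it too. -/
lemma deviation_succ {n : ℕ} (hn : n ≠ 0) (r : ℕ) : deviation n (n + 1) (r + 1) =
    deviation n n (r + 1) + starAverage n (deviation n (n + 1) r) := by
  simp only [deviation, scaledCount_succ, scaledTotal_succ hn, map_sub, map_smul,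
    starAverage_parityUniform hn, add_smul]
  abel

/-- No cancellation is needed: both terms are controlled by the scaled total, which is summable. -/
lemma tendsto_deviation_self {n : ℕ} (hn : n ≠ 0) :
    Tendsto (deviation n n) atTop (𝓝 0) := by
  have ha : Tendsto (scaledTotal n n) atTop (𝓝 0) :=
    (hasSum_scaledTotal hn).summable.tendsto_atTop_zero
  have hcount : Tendsto (scaledCount n n) atTop (𝓝 0) := by
    refine ((PiLp.continuous_toLp 2 fun _ : Perm (Fin (n + 1)) => ℝ).tendsto 0).comp
      (tendsto_pi_nhds.2 fun σ => ?_)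
    refine squeeze_zero (fun r => by positivity) (fun r => ?_) ha
    refine mul_le_mul_of_nonneg_right ?_ (by positivity)
    exact Finset.single_le_sum (f := fun σ : Perm (Fin (n + 1)) => ((walksBelow n r σ).ncard : ℝ))
      (fun _ _ => Nat.cast_nonneg _) (Finset.mem_univ σ)
  have hunif : Tendsto (fun r => scaledTotal n n r • parityUniform n r) atTop (𝓝 0) := by
    rw [tendsto_zero_iff_norm_tendsto_zero]
    refine squeeze_zero (g := fun r => |scaledTotal n n r| *
      max ‖parityUniform n 0‖ ‖parityUniform n 1‖) (fun _ => norm_nonneg _) (fun r => ?_) ?_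
    · rw [norm_smul, Real.norm_eq_abs]
      refine mul_le_mul_of_nonneg_left ?_ (abs_nonneg _)
      rcases neg_one_pow_eq_or ℝ r with h | h
      · exact le_max_of_le_left (le_of_eq (by simp only [parityUniform, h, pow_zero]))
      · exact le_max_of_le_right (le_of_eq (by simp only [parityUniform, h, pow_one]))
    · simpa using ha.abs.mul_const (max ‖parityUniform n 0‖ ‖parityUniform n 1‖)
  have h := hcount.sub hunif
  rwa [sub_zero] at h

lemma tendsto_deviation_succ {n : ℕ} (hn : n ≠ 0) :
    Tendsto (deviation n (n + 1)) atTop (𝓝 0) := by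
  obtain ⟨q, hq0, hq1, hq⟩ := exists_norm_starAverage_le hn
  rw [tendsto_zero_iff_norm_tendsto_zero]
  refine tendsto_zero_of_le_add_mul (fun _ => norm_nonneg _) hq0 hq1 (fun r => ?_)
    (tendsto_zero_iff_norm_tendsto_zero.1 (tendsto_deviation_self hn))
  rw [deviation_succ hn]
  exact (norm_add_le _ _).trans (add_le_add le_rfl
    (hq _ (sum_deviation hn _ _) (sum_realSign_mul_deviation hn le_rfl _)))

/-! ### Asymptotics at the identity -/

lemma tendsto_ncard_walksBelow {n : ℕ} (hn : n ≠ 0) :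
    Tendsto (fun k => ((walksBelow (n + 1) (2 * k) (1 : Perm (Fin (n + 1)))).ncard : ℝ) *
      (n : ℝ)⁻¹ ^ (2 * k)) atTop
      (𝓝 ((n : ℝ) ^ n / (n.factorial : ℝ) * (2 / ((n + 1).factorial : ℝ)))) := by
  have h2 : Tendsto (fun k : ℕ => 2 * k) atTop atTop :=
    tendsto_id.const_mul_atTop' two_pos
  have h1 : Tendsto (fun r => deviation n (n + 1) r 1) atTop (𝓝 0) :=
    ((EuclideanSpace.proj (𝕜 := ℝ) (1 : Perm (Fin (n + 1)))).continuous.tendsto' 0 0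
      (by simp)).comp (tendsto_deviation_succ hn)
  have h3 := (h1.comp h2).add (((tendsto_scaledTotal hn).comp h2).mul_const
    (2 / ((n + 1).factorial : ℝ)))
  rw [zero_add] at h3
  refine h3.congr fun k => ?_
  simp only [Function.comp_apply, deviation_apply, scaledCount_apply, parityUniform_apply, pow_mul,
    realSign]
  norm_num

end MonotoneHurwitz

theorem mainTheorem7 (d : ℕ) (hd : 1 ≤ d) :
    Asymptotics.IsEquivalent Filter.atTop
      (fun g : ℤ => (MonotoneHurwitz.simpleHurwitz d g : ℝ))
      (fun g : ℤ =>
        2 * ((d : ℝ) - 1) ^ (3 * d - 3) / ((Nat.factorial (d - 1) : ℝ) * (Nat.factorial d : ℝ))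
          * ((d : ℝ) - 1) ^ (2 * g)) := by
  obtain ⟨n, rfl⟩ : ∃ n, d = n + 1 := ⟨d - 1, by omega⟩
  rcases eq_or_ne n 0 with rfl | hn
  -- For `d = 1` there are no edges; for `g > 0` the length is positive and the right side contains
  -- `0 ^ (2 * g) = 0`.
  · refine Asymptotics.IsEquivalent.congr_left Asymptotics.IsEquivalent.refl ?_
    filter_upwards [Filter.eventually_gt_atTop 0] with g hg
    obtain ⟨k, hk⟩ : ∃ k, g.toNat = k + 1 := ⟨g.toNat - 1, by omega⟩
    rw [MonotoneHurwitz.simpleHurwitz_eq hd hg.le, hk]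
    have h := MonotoneHurwitz.ncard_walksBelow_succ (0 : Fin 1) (2 * k + 1) 1
    simp only [Fin.val_zero, zero_add, MonotoneHurwitz.walksBelow_zero_succ, Set.ncard_empty,
      show Finset.Iio (0 : Fin 1) = ∅ from rfl, Finset.sum_empty] at h
    have hg0 : (2 * g) ≠ 0 := by omega
    rw [show 2 * (k + 1 + (0 + 1 - 1)) = 2 * k + 1 + 1 by ring, zero_add, h]
    simp [zero_zpow _ hg0]
  · have hn' : (n : ℝ) ≠ 0 := Nat.cast_ne_zero.2 hn
    have hf : (n.factorial : ℝ) ≠ 0 := Nat.cast_ne_zero.2 (Nat.factorial_ne_zero _)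
    have hf' : ((n + 1).factorial : ℝ) ≠ 0 := Nat.cast_ne_zero.2 (Nat.factorial_ne_zero _)
    obtain ⟨c, hc⟩ : ∃ c : ℝ, c = (n : ℝ) ^ n / (n.factorial : ℝ) *
      (2 / ((n + 1).factorial : ℝ)) := ⟨_, rfl⟩
    have hc0 : c ≠ 0 := by rw [hc]; positivity
    have hlim : Filter.Tendsto (fun g : ℤ => g.toNat + n) Filter.atTop Filter.atTop := by
      refine Filter.tendsto_atTop.2 fun b => ?_
      filter_upwards [Filter.eventually_ge_atTop (b : ℤ)] with g hg
      omega
    have h := ((MonotoneHurwitz.tendsto_ncard_walksBelow hn).comp hlim).div_const c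
    rw [← hc, div_self hc0] at h
    refine Asymptotics.isEquivalent_of_tendsto_one (h.congr' ?_)
    -- The length `2 * (g + n)` contributes `n ^ (2 * n)`, which with `n ^ n` from the limit `c`
    -- gives the exponent `3 * n`.
    filter_upwards [Filter.eventually_ge_atTop 0] with g hg
    lift g to ℕ using hg
    rw [Pi.div_apply, MonotoneHurwitz.simpleHurwitz_eq hd (Int.natCast_nonneg g)]
    change (((MonotoneHurwitz.walksBelow (n + 1) (2 * (g + n)) 1).ncard : ℝ) *
      (n : ℝ)⁻¹ ^ (2 * (g + n))) / c =
        ((MonotoneHurwitz.walksBelow (n + 1) (2 * (g + n)) 1).ncard : ℝ) / _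
    generalize ((MonotoneHurwitz.walksBelow (n + 1) (2 * (g + n)) 1).ncard : ℝ) = N
    have e1 : 3 * (n + 1) - 3 = 3 * n := by omega
    have e2 : (2 * (g : ℤ)) = ((2 * g : ℕ) : ℤ) := by push_cast; rfl
    rw [e1, e2, zpow_natCast]
    simp only [inv_pow, Nat.add_sub_cancel, Nat.cast_add,
      Nat.cast_one, add_sub_cancel_right, hc]
    field_simp
    ring
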